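/- Let $G$ be a finite group and let $\tau\colon G\to G$ be an involutory anti-automorphism, i.e. $\tau(gh)=\tau(h)\tau(g)$ and $\tau(\tau(g))=g$ for all $g,h\in G$. All representations are finite-dimensional and complex. A representation is called multiplicity-free if it is a direct sum of pairwise inequivalent irreducible representations. For a representation $\rho$ of $G$ on $V$, its $\tau$-conjugate $\rho^\tau$ is the representation of $G$ on the dual space $V'$ given by $[\rho^\tau(g)f](v)=f(\rho(\tau(g))v)$, and its conjugate $\rho'$ is the representation on $V'$ given by $[\rho'(g)f](v)=f(\rho(g^{-1})v)$. The group $G$ is called $\tau$-simply reducible if (i) $\rho_1\otimes\rho_2$ is multiplicity-free for all irreducible representations $\rho_1,\rho_2$ of $G$, and (ii) $\rho^\tau$ is equivalent to $\rho$ for every irreducible representation $\rho$ of $G$. It is called simply reducible if (i) holds and $\rho'$ is equivalent to $\rho$ for every irreducible $\rho$. For $g\in G$ put $$\zeta_\tau(g)=|\{h\in G:\tau(h^{-1})h=g\}|,\qquad \zeta(g)=|\{h\in G:h^2=g\}|,\qquad v(g)=|\{h\in G:hg=gh\}|.$$ Then $G$ is $\tau$-simply reducible if and only if $$\sum_{g\in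 G}\zeta_\tau(g)^3=\sum_{g\in G}v(g)^2.$$ In particular (Wigner's criterion), $G$ is simply reducible if and only if $\sum_{g\in G}\zeta(g)^3=\sum_{g\in G}v(g)^2$. -/

import Mathlib

open scoped TensorProduct

universe u

/-- `τ : G → G` is an involutory anti-automorphism of the group `G`: it reverses products and
`τ ∘ τ = id` (so it is a bijection). -/
structure IsInvolutoryAntiAut {G : Type u} [Group G] (τ : G → G) : Prop where
  map_mul : ∀ g h : G, τ (g * h) = τ h * τ g
  apply_apply : ∀ g : G, τ (τ g) = g

theorem IsInvolutoryAntiAut.map_one {G : Type u} [Group G] {τ : G → G}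
    (hτ : IsInvolutoryAntiAut τ) : τ 1 = 1 := by
  have h := hτ.map_mul 1 1
  rw [mul_one] at h
  exact left_eq_mul.mp h

/-- The `τ`-conjugate `ρ^τ` of a complex representation `ρ` on `V`: it acts on the dual space of
`V` by `(ρ^τ(g) f)(v) = f (ρ(τ g) v)`. -/
def tauConj {G : Type u} [Group G] {τ : G → G} (hτ : IsInvolutoryAntiAut τ)
    {V : Type u} [AddCommGroup V] [Module ℂ V] (ρ : Representation ℂ G V) :
    Representation ℂ G (Module.Dual ℂ V) where
  toFun g := Module.Dual.transpose (R := ℂ) (ρ (τ g))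
  map_one' := by
    ext f v
    simp [hτ.map_one, Module.Dual.transpose_apply]
  map_mul' g h := by
    ext f v
    simp [hτ.map_mul, Module.Dual.transpose_apply]

/-- A complex representation is multiplicity-free if it is the (internal) direct sum of finitely
many irreducible subrepresentations that are pairwise inequivalent. -/
def IsMultiplicityFree {G : Type u} [Group G] {V : Type u} [AddCommGroup V] [Module ℂ V]
    (ρ : Representation ℂ G V) : Prop :=
  ∃ (n : ℕ) (σ : Fin n → Subrepresentation ρ),
    (∀ i, (σ i).toRepresentation.IsIrreducible) ∧
    (∀ i j, i ≠ j → IsEmpty ((σ i).toRepresentation.Equiv (σ j).toRepresentation)) ∧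
    DirectSum.IsInternal (fun i => (σ i).toSubmodule)

/-- Every Kronecker product of two irreducible (finite-dimensional, complex) representations of
`G` is multiplicity-free. -/
def KroneckerMultiplicityFree (G : Type u) [Group G] : Prop :=
  ∀ (V W : Type u) [AddCommGroup V] [Module ℂ V] [FiniteDimensional ℂ V]
    [AddCommGroup W] [Module ℂ W] [FiniteDimensional ℂ W]
    (ρ₁ : Representation ℂ G V) (ρ₂ : Representation ℂ G W),
    ρ₁.IsIrreducible → ρ₂.IsIrreducible → IsMultiplicityFree (ρ₁.tprod ρ₂)

/-- `G` is `τ`-simply reducible: Kronecker products of irreducible representations are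
multiplicity-free, and every irreducible representation is equivalent to its `τ`-conjugate. -/
def IsTauSimplyReducible (G : Type u) [Group G] {τ : G → G} (hτ : IsInvolutoryAntiAut τ) : Prop :=
  KroneckerMultiplicityFree G ∧
  ∀ (V : Type u) [AddCommGroup V] [Module ℂ V] [FiniteDimensional ℂ V]
    (ρ : Representation ℂ G V), ρ.IsIrreducible → Nonempty ((tauConj hτ ρ).Equiv ρ)

/-- `G` is simply reducible: Kronecker products of irreducible representations are
multiplicity-free, and every irreducible representation is equivalent to its conjugate (dual,
contragredient) representation. -/
def IsSimplyReducible (G : Type u) [Group G] : Prop :=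
  KroneckerMultiplicityFree G ∧
  ∀ (V : Type u) [AddCommGroup V] [Module ℂ V] [FiniteDimensional ℂ V]
    (ρ : Representation ℂ G V), ρ.IsIrreducible → Nonempty (ρ.dual.Equiv ρ)

/-- `ζ_τ(g)`, the number of `h ∈ G` with `τ(h⁻¹) h = g`. -/
noncomputable def zetaTau {G : Type u} [Group G] (τ : G → G) (g : G) : ℕ :=
  Nat.card {h : G // τ h⁻¹ * h = g}

/-- `ζ(g)`, the number of square roots of `g` in `G`. -/
noncomputable def zetaSq {G : Type u} [Group G] (g : G) : ℕ :=
  Nat.card {h : G // h ^ 2 = g}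

/-- `v(g)`, the order of the centralizer of `g` in `G`. -/
noncomputable def centralizerOrder {G : Type u} [Group G] (g : G) : ℕ :=
  Nat.card {h : G // h * g = g * h}

/-!
Let `χᵢ` be the irreducible characters of `G`, let `mᵢⱼₖ` be the dimension of the invariants of
`ρᵢ ⊗ ρⱼ ⊗ ρₖ`, and let `εᵢ = |G|⁻¹ ∑ χᵢ(τ(h⁻¹)h)` be the twisted Frobenius–Schur indicator. The
class function `ζ_τ` equals `∑ εᵢ χᵢ`, and `v(g) = ∑ χᵢ(g) χᵢ(g⁻¹)` by column orthogonality. Hence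
`∑ ζ_τ(g)³ = |G| ∑ εᵢ εⱼ εₖ mᵢⱼₖ` (`IrrepSystem.sum_zetaTau_pow_three`) and
`∑ v(g)² = |G| ∑ mᵢⱼₖ²` (`IrrepSystem.sum_centralizerOrder_sq`).

By Schur's lemma `εᵢ` is `0` unless `ρᵢ` is equivalent to its `τ`-conjugate; if it is, the
equivalence is a nondegenerate bilinear form `B` with `B(ρ(g)v, w) = B(v, ρ(τ g)w)`, which is
symmetric or antisymmetric, and `εᵢ` is its sign (`exists_isTwistedForm`). In particular
`εᵢ εⱼ εₖ mᵢⱼₖ ≤ mᵢⱼₖ²` for every triple, so the two sums agree exactly when equality holds for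
every triple (`IrrepSystem.sum_eq_sum_iff`).

If it does, all `mᵢⱼₖ` are at most `1`, which says that Kronecker products are multiplicity-free,
and no `εᵢ` vanishes, because each `i` has some `mᵢᵢₖ ≠ 0`. Conversely, if `G` is `τ`-simply
reducible, all that is missing is `εᵢ εⱼ εₖ = 1` whenever `mᵢⱼₖ = 1`. This product is the sign of
the tensor product form on `ρᵢ ⊗ ρⱼ ⊗ ρₖ`. The invariants there are spanned by one vector `w`, and
nondegeneracy forces `B(w, w) ≠ 0`, so the sign is `1`
(`IsTwistedForm.eq_one_of_finrank_invariants`).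

Wigner's criterion is the case `τ(g) = g⁻¹`, for which the `τ`-conjugate is the dual.
-/

open Representation

/-! ### Decomposition into irreducibles, and the `τ`-conjugate of an irreducible -/

section Basics

variable {G : Type u} [Group G]

theorem nontrivial_of_isIrreducible {V : Type*} [AddCommGroup V] [Module ℂ V]
    {ρ : Representation ℂ G V} (h : ρ.IsIrreducible) : Nontrivial V := by
  by_contra hV
  rw [not_nontrivial_iff_subsingleton] at hV
  exact bot_ne_top (α := Subrepresentation ρ)
    (Subrepresentation.toSubmodule_injective (Subsingleton.elim _ _))

theorem isIrreducible_of_isAtom {V : Type*} [AddCommGroup V] [Module ℂ V]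
    {π : Representation ℂ G V} {σ : Subrepresentation π} (hσ : IsAtom σ) :
    σ.toRepresentation.IsIrreducible := by
  have key : ∀ U : Subrepresentation σ.toRepresentation, U = ⊥ ∨ U = ⊤ := by
    intro U
    let W : Subrepresentation π := ⟨U.toSubmodule.map σ.toSubmodule.subtype, by
      rintro g _ ⟨v, hv, rfl⟩
      exact ⟨_, U.apply_mem_toSubmodule g hv, rfl⟩⟩
    have hW : W ≤ σ := by
      rintro _ ⟨v, -, rfl⟩
      exact v.2
    rcases hσ.le_iff.1 hW with h | h
    · left
      apply Subrepresentation.toSubmodule_injective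
      apply Submodule.map_injective_of_injective σ.toSubmodule.injective_subtype
      exact (congrArg Subrepresentation.toSubmodule h).trans (Submodule.map_bot _).symm
    · right
      apply Subrepresentation.toSubmodule_injective
      apply Submodule.map_injective_of_injective σ.toSubmodule.injective_subtype
      exact (congrArg Subrepresentation.toSubmodule h).trans (Submodule.map_subtype_top _).symm
  refine { exists_pair_ne := ⟨⊥, ⊤, fun h => hσ.1 ?_⟩, eq_bot_or_eq_top := key }
  have h' : (⊥ : Submodule ℂ σ.toSubmodule) = ⊤ := congrArg Subrepresentation.toSubmodule h
  apply Subrepresentation.toSubmodule_injective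
  have := congrArg (Submodule.map σ.toSubmodule.subtype) h'
  rw [Submodule.map_bot, Submodule.map_subtype_top] at this
  exact this.symm

/-- Maschke's theorem, in the form of an internal direct sum indexed by `Fin n`. -/
theorem exists_isInternal_isIrreducible [Finite G] {V : Type*} [AddCommGroup V] [Module ℂ V]
    [FiniteDimensional ℂ V] (π : Representation ℂ G V) :
    ∃ (n : ℕ) (σ : Fin n → Subrepresentation π),
      (∀ i, (σ i).toRepresentation.IsIrreducible) ∧
      DirectSum.IsInternal (fun i => (σ i).toSubmodule) := by
  have : NeZero (Nat.card G : ℂ) := ⟨Nat.cast_ne_zero.2 Nat.card_pos.ne'⟩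
  have : IsSemisimpleModule (MonoidAlgebra ℂ G) π.asModule := inferInstance
  have : IsNoetherian (MonoidAlgebra ℂ G) π.asModule := by
    have : IsNoetherian ℂ π.asModule := inferInstanceAs (IsNoetherian ℂ V)
    exact isNoetherian_of_tower ℂ this
  obtain ⟨s, h1, h2, h3⟩ :=
    IsSemisimpleModule.exists_sSupIndep_sSup_simples_eq_top (MonoidAlgebra ℂ G) π.asModule
  have hs : s.Finite := WellFoundedGT.finite_of_sSupIndep h1
  have : Fintype s := hs.fintype
  let e := Fintype.equivFin s
  have hint : DirectSum.IsInternal (fun i =>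
      ((e.symm i : s) : Submodule (MonoidAlgebra ℂ G) π.asModule)) := by
    rw [DirectSum.isInternal_submodule_iff_iSupIndep_and_iSup_eq_top]
    constructor
    · exact ((sSupIndep_iff s).1 h1).comp e.symm.injective
    · rw [e.symm.iSup_comp (g := fun i : s => (i : Submodule (MonoidAlgebra ℂ G) π.asModule)),
        ← sSup_eq_iSup', h2]
  refine ⟨Fintype.card s, fun i => Subrepresentation.ofSubmodule' (e.symm i : s).1, fun i => ?_, ?_⟩
  · have hsimple := h3 _ (e.symm i).2
    rw [isSimpleModule_iff_isAtom] at hsimple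
    refine isIrreducible_of_isAtom ?_
    exact (OrderIso.isAtom_iff
      Subrepresentation.subrepresentationSubmoduleOrderIso.symm _).2 hsimple
  · exact hint

theorem character_eq_sum_of_isInternal {V : Type*} [AddCommGroup V] [Module ℂ V]
    [FiniteDimensional ℂ V] {π : Representation ℂ G V} {ι : Type*} [Fintype ι]
    [DecidableEq ι] {σ : ι → Subrepresentation π}
    (h : DirectSum.IsInternal (fun i => (σ i).toSubmodule)) (g : G) :
    π.character g = ∑ i, (σ i).toRepresentation.character g :=
  LinearMap.trace_eq_sum_trace_restrict h (fun i => (σ i).apply_mem_toSubmodule g)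

theorem tauConj_character {τ : G → G} (hτ : IsInvolutoryAntiAut τ) {V : Type u} [AddCommGroup V]
    [Module ℂ V] [FiniteDimensional ℂ V] (ρ : Representation ℂ G V) (g : G) :
    (tauConj hτ ρ).character g = ρ.character (τ g) :=
  LinearMap.trace_transpose' (ρ (τ g))

theorem isInvolutoryAntiAut_inv : IsInvolutoryAntiAut (fun g : G => g⁻¹) :=
  ⟨mul_inv_rev, inv_inv⟩

/-- A subrepresentation of the `τ`-conjugate is the annihilator of a subrepresentation of `ρ`. -/
theorem tauConj_isIrreducible {τ : G → G} (hτ : IsInvolutoryAntiAut τ) {V : Type u} [AddCommGroup V]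
    [Module ℂ V] [FiniteDimensional ℂ V] (ρ : Representation ℂ G V) (hρ : ρ.IsIrreducible) :
    (tauConj hτ ρ).IsIrreducible := by
  have key : ∀ U : Subrepresentation (tauConj hτ ρ), U = ⊥ ∨ U = ⊤ := by
    intro U
    let W : Subrepresentation ρ := ⟨U.toSubmodule.dualCoannihilator, fun g v hv => by
      rw [Submodule.mem_dualCoannihilator] at hv ⊢
      intro φ hφ
      have := hv _ (U.apply_mem_toSubmodule (τ g) hφ)
      simpa [tauConj, hτ.apply_apply, Module.Dual.transpose_apply] using this⟩
    have hU : W.toSubmodule.dualAnnihilator = U.toSubmodule :=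
      Subspace.dualCoannihilator_dualAnnihilator_eq
    rcases IsSimpleOrder.eq_bot_or_eq_top W with h | h
    · right
      apply Subrepresentation.toSubmodule_injective
      rw [← hU, h]
      exact Submodule.dualAnnihilator_bot
    · left
      apply Subrepresentation.toSubmodule_injective
      rw [← hU, h]
      exact Submodule.dualAnnihilator_top
  have hnt := nontrivial_of_isIrreducible hρ
  refine { exists_pair_ne := ⟨⊥, ⊤, fun h => ?_⟩, eq_bot_or_eq_top := key }
  exact bot_ne_top (α := Submodule ℂ (Module.Dual ℂ V)) (congrArg Subrepresentation.toSubmodule h)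

end Basics

/-! ### The irreducible characters span the class functions -/

section CharacterTheory

variable {G : Type u} [Group G] [Fintype G]

noncomputable instance instInvertibleNatCard : Invertible (Nat.card G : ℂ) :=
  invertibleOfNonzero (Nat.cast_ne_zero.2 Nat.card_pos.ne')

omit [Fintype G] in
theorem natCard_ne_zero [Finite G] : (Nat.card G : ℂ) ≠ 0 := Nat.cast_ne_zero.2 Nat.card_pos.ne'

/-- The symmetric bilinear pairing `|G|⁻¹ ∑ a(g) b(g⁻¹)` of functions on `G`. On characters it
agrees with the usual Hermitian inner product, since `χ(g⁻¹)` is the complex conjugate of `χ(g)`. -/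
noncomputable def charPairing (a b : G → ℂ) : ℂ :=
  (Nat.card G : ℂ)⁻¹ * ∑ g : G, a g * b g⁻¹

theorem charPairing_sub (a b c : G → ℂ) :
    charPairing (a - b) c = charPairing a c - charPairing b c := by
  simp [charPairing, sub_mul, Finset.sum_sub_distrib, mul_sub]

theorem charPairing_sum_smul {ι : Type*} (s : Finset ι) (c : ι → ℂ) (a : ι → G → ℂ) (b : G → ℂ) :
    charPairing (∑ i ∈ s, c i • a i) b = ∑ i ∈ s, c i * charPairing (a i) b := by
  simp only [charPairing, Finset.sum_apply, Pi.smul_apply, smul_eq_mul, Finset.sum_mul,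
    Finset.mul_sum]
  rw [Finset.sum_comm]
  exact Finset.sum_congr rfl fun i _ => Finset.sum_congr rfl fun g _ => by ring

variable (G) in
/-- A complete system of representatives of the isomorphism classes of irreducible
finite-dimensional complex representations of `G` (on spaces in the universe of `G`). -/
structure IrrepSystem where
  /-- The finite index set. -/
  ι : Type
  [fintype : Fintype ι]
  [decEq : DecidableEq ι]
  /-- The space of the representation with index `i`. -/
  V : ι → Type u
  [addCommGroup : ∀ i, AddCommGroup (V i)]
  [module : ∀ i, Module ℂ (V i)]
  [finiteDimensional : ∀ i, FiniteDimensional ℂ (V i)]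
  /-- The representation with index `i`. -/
  rep : ∀ i, Representation ℂ G (V i)
  irreducible : ∀ i, (rep i).IsIrreducible
  inequivalent : ∀ i j, i ≠ j → IsEmpty ((rep i).Equiv (rep j))
  complete : ∀ (V : Type u) [AddCommGroup V] [Module ℂ V] [FiniteDimensional ℂ V]
    (ρ : Representation ℂ G V), ρ.IsIrreducible →
    ∃ i, Nonempty (ρ.Equiv (rep i))

attribute [instance] IrrepSystem.fintype IrrepSystem.decEq IrrepSystem.addCommGroup
  IrrepSystem.module IrrepSystem.finiteDimensional IrrepSystem.irreducible

omit [Fintype G] in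
/-- Every irreducible `ρ` occurs in the regular representation: a nonzero vector gives a nonzero
intertwining map from the regular representation to `ρ`, which is nonzero on some summand. -/
theorem exists_equiv_of_isInternal_leftRegular {n : ℕ}
    {σ : Fin n → Subrepresentation (leftRegular ℂ G)}
    (hirr : ∀ i, (σ i).toRepresentation.IsIrreducible)
    (hσ : DirectSum.IsInternal (fun i => (σ i).toSubmodule))
    {V : Type*} [AddCommGroup V] [Module ℂ V]
    (ρ : Representation ℂ G V) (hρ : ρ.IsIrreducible) :
    ∃ i, Nonempty (ρ.Equiv (σ i).toRepresentation) := by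
  by_contra! hne
  have := nontrivial_of_isIrreducible hρ
  obtain ⟨v, hv⟩ := exists_ne (0 : V)
  let f := (leftRegularMapEquiv ρ).symm v
  have hf : f ≠ 0 := fun h => hv ((leftRegularMapEquiv ρ).symm.map_eq_zero_iff.1 h)
  apply hf
  have hsup := hσ.submodule_iSup_eq_top
  apply IntertwiningMap.ext
  rw [IntertwiningMap.zero_toLinearMap, ← LinearMap.ker_eq_top, eq_top_iff, ← hsup, iSup_le_iff]
  intro i v hv
  let fi : IntertwiningMap (σ i).toRepresentation ρ :=
    ⟨f.toLinearMap ∘ₗ (σ i).toSubmodule.subtype, fun g => by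
      ext w; exact IntertwiningMap.isIntertwining _ _ f g w.1⟩
  have := hirr i
  have hemp : IsEmpty ((σ i).toRepresentation.Equiv ρ) :=
    ⟨fun e => (hne i).false e.symm⟩
  have : fi = 0 := Subsingleton.elim _ _
  exact congrArg (fun F : IntertwiningMap (σ i).toRepresentation ρ => F ⟨v, hv⟩) this

variable (G) in
theorem exists_irrepSystem : Nonempty (IrrepSystem G) := by
  classical
  obtain ⟨n, σ, hirr, hσ⟩ := exists_isInternal_isIrreducible (leftRegular ℂ G)
  let s : Setoid (Fin n) :=
    { r := fun i j => Nonempty ((σ i).toRepresentation.Equiv (σ j).toRepresentation)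
      iseqv := ⟨fun i => ⟨.refl _⟩, fun ⟨e⟩ => ⟨e.symm⟩, fun ⟨e⟩ ⟨e'⟩ => ⟨e.trans e'⟩⟩ }
  exact ⟨{
    ι := Quotient s
    fintype := Fintype.ofFinite _
    decEq := Classical.decEq _
    V := fun q => (σ q.out).toSubmodule
    rep := fun q => (σ q.out).toRepresentation
    irreducible := fun q => hirr _
    inequivalent := fun q q' h => ⟨fun e => h (by
      rw [← Quotient.out_eq q, ← Quotient.out_eq q']
      exact Quotient.sound ⟨e⟩)⟩
    complete := fun V _ _ _ ρ hρ => by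
      obtain ⟨i, ⟨e⟩⟩ := exists_equiv_of_isInternal_leftRegular hirr hσ ρ hρ
      obtain ⟨e'⟩ : Nonempty ((σ i).toRepresentation.Equiv
          (σ (Quotient.mk s i).out).toRepresentation) :=
        s.symm (Quotient.mk_out (s := s) i)
      exact ⟨Quotient.mk s i, ⟨e.trans e'⟩⟩ }⟩

/-- The operator `∑ f(g) ρ(g⁻¹)`, which commutes with `ρ` because `f` is a class function. -/
noncomputable def classOperator {V : Type*} [AddCommGroup V] [Module ℂ V]
    (ρ : Representation ℂ G V) (f : G → ℂ) (hf : ∀ g h, f (h * g * h⁻¹) = f g) :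
    IntertwiningMap ρ ρ :=
  ⟨∑ g, f g • ρ g⁻¹, fun h => by
    change (∑ g, f g • ρ g⁻¹) * ρ h = ρ h * ∑ g, f g • ρ g⁻¹
    rw [Finset.sum_mul, Finset.mul_sum]
    refine (Equiv.sum_comp (MulAut.conj h).toEquiv _).symm.trans
      (Finset.sum_congr rfl fun g _ => ?_)
    simp only [MulEquiv.toEquiv_eq_coe, MulEquiv.coe_toEquiv, MulAut.conj_apply, hf]
    rw [smul_mul_assoc, mul_smul_comm, ← map_mul, ← map_mul]
    congr 2
    group⟩

theorem classOperator_apply {V : Type*} [AddCommGroup V] [Module ℂ V]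
    (ρ : Representation ℂ G V) (f : G → ℂ) (hf : ∀ g h, f (h * g * h⁻¹) = f g) (v : V) :
    classOperator ρ f hf v = ∑ g, f g • ρ g⁻¹ v := by
  change (∑ g, f g • ρ g⁻¹ : V →ₗ[ℂ] V) v = _
  simp

/-- By Schur's lemma the operator is a scalar, and its trace is `|G|` times the pairing of `f` with
the character. -/
theorem classOperator_eq_zero {V : Type*} [AddCommGroup V] [Module ℂ V] [FiniteDimensional ℂ V]
    (ρ : Representation ℂ G V) [hρ : ρ.IsIrreducible] (f : G → ℂ)
    (hf : ∀ g h, f (h * g * h⁻¹) = f g) (h0 : charPairing f ρ.character = 0) :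
    classOperator ρ f hf = 0 := by
  have := nontrivial_of_isIrreducible hρ
  obtain ⟨c, hc⟩ := (IsIrreducible.algebraMap_intertwiningMap_bijective_of_isAlgClosed (ρ := ρ)
    ).2 (classOperator ρ f hf)
  have htr : LinearMap.trace ℂ V (classOperator ρ f hf).toLinearMap = 0 := by
    change LinearMap.trace ℂ V (∑ g, f g • ρ g⁻¹) = 0
    have := (mul_eq_zero.1 h0).resolve_left (inv_ne_zero natCard_ne_zero)
    simpa [character] using this
  have hc' : (classOperator ρ f hf).toLinearMap = c • LinearMap.id := by
    rw [← hc]; rfl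
  rw [hc', map_smul, LinearMap.trace_id, smul_eq_mul, mul_eq_zero] at htr
  have hc0 : c = 0 := htr.resolve_right (Nat.cast_ne_zero.2 Module.finrank_pos.ne')
  rw [← hc, hc0, map_zero]

namespace IrrepSystem

variable (S : IrrepSystem G)

/-- The character with index `i`. -/
noncomputable def char (i : S.ι) : G → ℂ := (S.rep i).character

theorem charPairing_char (i j : S.ι) :
    charPairing (S.char i) (S.char j) = if i = j then 1 else 0 := by
  have h := char_orthonormal (S.rep i) (S.rep j)
  rw [charPairing]
  refine h.trans ?_
  by_cases hij : i = j
  · subst hij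
    rw [if_pos rfl, if_pos ⟨.refl _⟩]
  · rw [if_neg hij, if_neg]
    exact not_nonempty_iff.2 (S.inequivalent j i (Ne.symm hij))

omit [Fintype G] in
theorem exists_char_eq {V : Type u} [AddCommGroup V] [Module ℂ V] [FiniteDimensional ℂ V]
    (ρ : Representation ℂ G V) (hρ : ρ.IsIrreducible) : ∃ i, ρ.character = S.char i := by
  obtain ⟨i, ⟨e⟩⟩ := S.complete V ρ hρ
  exact ⟨i, char_iso e⟩

/-- The class operator of such an `f` vanishes on every irreducible summand of the regular
representation; evaluating it at the unit of the group algebra gives the values of `f`. -/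
theorem eq_zero_of_charPairing_eq_zero {f : G → ℂ} (hf : ∀ g h, f (h * g * h⁻¹) = f g)
    (h0 : ∀ i, charPairing f (S.char i) = 0) : f = 0 := by
  obtain ⟨n, σ, hirr, hσ⟩ := exists_isInternal_isIrreducible (leftRegular ℂ G)
  have hT : (classOperator (leftRegular ℂ G) f hf).toLinearMap = 0 := by
    rw [← LinearMap.ker_eq_top, eq_top_iff, ← hσ.submodule_iSup_eq_top, iSup_le_iff]
    intro l v hv
    obtain ⟨i, hi⟩ := S.exists_char_eq _ (hirr l)
    have := hirr l
    have h := classOperator_eq_zero (σ l).toRepresentation f hf (by rw [hi, h0])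
    have h' := congrArg (fun F : IntertwiningMap (σ l).toRepresentation (σ l).toRepresentation =>
      (F ⟨v, hv⟩ : MonoidAlgebra ℂ G)) h
    rw [IntertwiningMap.coe_zero, Pi.zero_apply] at h'
    simp only [classOperator_apply] at h'
    rw [LinearMap.mem_ker]
    refine (classOperator_apply _ f hf v).trans ?_
    simpa [Subrepresentation.toRepresentation] using h'
  have h1 := congrArg (fun F : MonoidAlgebra ℂ G →ₗ[ℂ] MonoidAlgebra ℂ G => F (.single 1 1)) hT
  have h2 := (classOperator_apply _ f hf _).symm.trans h1
  classical
  funext g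
  have h3 := congrArg (fun x : MonoidAlgebra ℂ G => x.coeff g⁻¹) h2
  simpa [Finsupp.single_apply, MonoidAlgebra.coeff_sum] using h3

theorem eq_sum_charPairing {f : G → ℂ} (hf : ∀ g h, f (h * g * h⁻¹) = f g) :
    f = ∑ i, charPairing f (S.char i) • S.char i := by
  rw [← sub_eq_zero]
  refine S.eq_zero_of_charPairing_eq_zero (fun g h => ?_) fun j => ?_
  · simp [hf, char]
  · rw [charPairing_sub, charPairing_sum_smul]
    simp [charPairing_char]

/-- Column orthogonality, from the expansion of the class function
`h ↦ #{t | t g t⁻¹ = h}` in irreducible characters. -/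
theorem sum_char_mul_char_inv (g h : G) :
    ∑ i, S.char i g⁻¹ * S.char i h = Nat.card {t : G // t * g * t⁻¹ = h} := by
  classical
  let f : G → ℂ := fun h => ∑ t : G, if t * g * t⁻¹ = h then 1 else 0
  have hf : ∀ x y, f (y * x * y⁻¹) = f x := by
    intro x y
    change (∑ t : G, if t * g * t⁻¹ = y * x * y⁻¹ then (1 : ℂ) else 0) = _
    rw [← Equiv.sum_comp (Equiv.mulLeft y)]
    refine Finset.sum_congr rfl fun t _ => ?_
    congr 1
    simp only [Equiv.coe_mulLeft, mul_inv_rev, eq_iff_iff]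
    rw [show y * t * g * (t⁻¹ * y⁻¹) = y * (t * g * t⁻¹) * y⁻¹ by group]
    simp
  have hp : ∀ i, charPairing f (S.char i) = S.char i g⁻¹ := by
    intro i
    rw [charPairing, inv_mul_eq_iff_eq_mul₀ natCard_ne_zero]
    simp only [f, Finset.sum_mul, ite_mul, one_mul, zero_mul]
    rw [Finset.sum_comm]
    simp only [Finset.sum_ite_eq, Finset.mem_univ, if_true]
    have : ∀ t : G, S.char i (t * g * t⁻¹)⁻¹ = S.char i g⁻¹ := by
      intro t
      rw [show (t * g * t⁻¹)⁻¹ = t * g⁻¹ * t⁻¹ by group]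
      exact char_conj _ _ _
    simp only [this, Finset.sum_const, Finset.card_univ, nsmul_eq_mul, Nat.card_eq_fintype_card]
  have := congrFun (S.eq_sum_charPairing hf) h
  simp only [hp, Finset.sum_apply, Pi.smul_apply, smul_eq_mul] at this
  rw [← this, Nat.card_eq_fintype_card, Fintype.card_subtype]
  simp [f]

theorem centralizerOrder_eq_sum (g : G) :
    (centralizerOrder g : ℂ) = ∑ i, S.char i g⁻¹ * S.char i g := by
  rw [sum_char_mul_char_inv, centralizerOrder]
  simp only [mul_inv_eq_iff_eq_mul]

end IrrepSystem

end CharacterTheory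

/-! ### Bilinear forms adapted to `τ` -/

section TwistedForms

variable {G : Type u} [Group G]

/-- `B` is a nondegenerate bilinear form on `V`, given as a map to the dual, such that
`B(ρ(g)v, w) = B(v, ρ(τ g)w)` and `B(v, w) = s B(w, v)`. Equivalently, it is an embedding of `ρ`
into its `τ`-conjugate with a prescribed symmetry `s`. -/
structure IsTwistedForm (τ : G → G) {V : Type*} [AddCommGroup V] [Module ℂ V]
    (ρ : Representation ℂ G V) (s : ℂ) (B : V →ₗ[ℂ] Module.Dual ℂ V) : Prop where
  injective : Function.Injective B
  apply_apply : ∀ g v w, B (ρ g v) w = B v (ρ (τ g) w)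
  swap : ∀ v w, B v w = s * B w v

theorem IsTwistedForm.tensor {τ : G → G} {V W : Type*} [AddCommGroup V] [Module ℂ V]
    [FiniteDimensional ℂ V] [AddCommGroup W] [Module ℂ W] [FiniteDimensional ℂ W]
    {ρ : Representation ℂ G V} {σ : Representation ℂ G W} {s t : ℂ}
    {B : V →ₗ[ℂ] Module.Dual ℂ V} {C : W →ₗ[ℂ] Module.Dual ℂ W}
    (hB : IsTwistedForm τ ρ s B) (hC : IsTwistedForm τ σ t C) :
    IsTwistedForm τ (ρ.tprod σ) (s * t)
      (TensorProduct.dualDistrib ℂ V W ∘ₗ TensorProduct.map B C) where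
  injective := by
    rw [LinearMap.coe_comp]
    exact (TensorProduct.dualDistribEquiv ℂ V W).injective.comp
      (TensorProduct.map_injective_of_flat_flat _ _ hB.injective hC.injective)
  apply_apply g x y := by
    induction x with
    | zero => simp
    | add x x' hx hx' => simp only [map_add, LinearMap.add_apply, hx, hx']
    | tmul v w =>
      induction y with
      | zero => simp
      | add y y' hy hy' => simp only [map_add, hy, hy']
      | tmul v' w' => simp [hB.apply_apply, hC.apply_apply]
  swap x y := by
    induction x with
    | zero => simp
    | add x x' hx hx' => simp only [map_add, LinearMap.add_apply, hx, hx', mul_add]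
    | tmul v w =>
      induction y with
      | zero => simp
      | add y y' hy hy' => simp only [map_add, LinearMap.add_apply, hy, hy', mul_add]
      | tmul v' w' =>
        simp only [LinearMap.comp_apply, TensorProduct.map_tmul, TensorProduct.dualDistrib_apply]
        rw [hB.swap v v', hC.swap w w']
        ring

theorem IsInvolutoryAntiAut.map_inv {τ : G → G} (hτ : IsInvolutoryAntiAut τ) (g : G) :
    τ g⁻¹ = (τ g)⁻¹ := by
  rw [eq_inv_iff_mul_eq_one, ← hτ.map_mul, mul_inv_cancel, hτ.map_one]

theorem IsInvolutoryAntiAut.sum_comp [Fintype G] {τ : G → G} (hτ : IsInvolutoryAntiAut τ)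
    {M : Type*} [AddCommMonoid M] (f : G → M) : ∑ g, f (τ g) = ∑ g, f g :=
  Equiv.sum_comp ⟨τ, τ, hτ.apply_apply, hτ.apply_apply⟩ f

/-- Let `w` span the invariants. Averaging over `G` gives `|G| B(w, v) = B(w, ∑ ρ(g)v)`, where
`∑ ρ(g)v` is a multiple of `w`; hence `B(w, w) ≠ 0` by nondegeneracy, and `B(w, w) = s B(w, w)`
forces `s = 1`. -/
theorem IsTwistedForm.eq_one_of_finrank_invariants [Fintype G] {τ : G → G}
    (hτ : IsInvolutoryAntiAut τ) {V : Type*} [AddCommGroup V] [Module ℂ V]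
    {ρ : Representation ℂ G V} {s : ℂ} {B : V →ₗ[ℂ] Module.Dual ℂ V}
    (hB : IsTwistedForm τ ρ s B) (h1 : Module.finrank ℂ ρ.invariants = 1) : s = 1 := by
  obtain ⟨⟨w, hw⟩, hw0, hspan⟩ := finrank_eq_one_iff'.1 h1
  have hw0 : w ≠ 0 := fun h => hw0 (Subtype.ext h)
  have hBw : B w w ≠ 0 := by
    intro h0
    apply hw0
    apply hB.injective
    rw [map_zero]
    ext v
    have hmem : ∑ g, ρ g v ∈ ρ.invariants := by
      intro h
      rw [map_sum]
      refine Eq.trans (Finset.sum_congr rfl fun g _ => ?_) (Equiv.sum_comp (Equiv.mulLeft h) _)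
      simp
    obtain ⟨c, hc⟩ := hspan ⟨_, hmem⟩
    have hc' : c • w = ∑ g, ρ g v := congrArg Subtype.val hc
    have hsum : ∑ g : G, B w (ρ g v) = Nat.card G * B w v := by
      rw [← hτ.sum_comp]
      simp [← hB.apply_apply, hw _]
    rw [← map_sum, ← hc', map_smul, h0, smul_zero] at hsum
    exact (mul_eq_zero.1 hsum.symm).resolve_left natCard_ne_zero
  have := hB.swap w w
  exact mul_right_cancel₀ hBw (by rw [one_mul, ← this])

end TwistedForms

/-! ### The twisted Frobenius–Schur indicator of an irreducible representation -/

section Indicator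

variable {G : Type u} [Group G] [Fintype G]

/-- The twisted Frobenius–Schur indicator `|G|⁻¹ ∑ χ(τ(h⁻¹)h)` of a function `χ` on `G`. -/
noncomputable def twistedIndicator (τ : G → G) (χ : G → ℂ) : ℂ :=
  (Nat.card G : ℂ)⁻¹ * ∑ h, χ (τ h⁻¹ * h)

variable {τ : G → G} (hτ : IsInvolutoryAntiAut τ) {V : Type u} [AddCommGroup V] [Module ℂ V]
    [FiniteDimensional ℂ V] (ρ : Representation ℂ G V)

/-- The sum over `G` of the translates of a linear map `X : V → V'`; it intertwines `ρ` with its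
`τ`-conjugate. -/
noncomputable def averageTwisted (X : V →ₗ[ℂ] Module.Dual ℂ V) :
    IntertwiningMap ρ (tauConj hτ ρ) :=
  ⟨∑ h, tauConj hτ ρ h⁻¹ ∘ₗ X ∘ₗ ρ h, fun g => by
    ext v w
    simp only [LinearMap.comp_apply, LinearMap.sum_apply, map_sum]
    refine (Equiv.sum_comp (Equiv.mulRight g⁻¹) _).symm.trans (Finset.sum_congr rfl fun h _ => ?_)
    simp [← Module.End.mul_apply, ← map_mul]⟩

omit [FiniteDimensional ℂ V] in
theorem averageTwisted_apply (X : V →ₗ[ℂ] Module.Dual ℂ V) (v : V) :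
    averageTwisted hτ ρ X v = ∑ h, tauConj hτ ρ h⁻¹ (X (ρ h v)) := by
  change (∑ h, tauConj hτ ρ h⁻¹ ∘ₗ X ∘ₗ ρ h) v = _
  simp

omit [FiniteDimensional ℂ V] in
/-- The trace defining the indicator, expanded into matrix coefficients of the averages of the
rank one maps `v ↦ b*_c(v) b*_a`. -/
theorem twistedIndicator_eq_sum {ι : Type*} [Fintype ι] (b : Module.Basis ι ℂ V) :
    twistedIndicator τ ρ.character = (Nat.card G : ℂ)⁻¹ * ∑ a, ∑ c,
      averageTwisted hτ ρ ((b.coord c).smulRight (b.coord a)) (b a) (b c) := by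
  classical
  rw [twistedIndicator]
  congr 1
  simp only [averageTwisted_apply, LinearMap.sum_apply]
  rw [Finset.sum_congr rfl fun a _ => Finset.sum_comm, Finset.sum_comm]
  refine Finset.sum_congr rfl fun h _ => ?_
  rw [character, LinearMap.trace_eq_matrix_trace ℂ b, Matrix.trace, map_mul,
    LinearMap.toMatrix_mul]
  refine Finset.sum_congr rfl fun a _ => ?_
  rw [Matrix.diag_apply, Matrix.mul_apply]
  refine Finset.sum_congr rfl fun c _ => ?_
  simp [tauConj, Module.Dual.transpose_apply, LinearMap.toMatrix_apply, mul_comm]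

omit [Fintype G] in
theorem nonempty_equiv_tauConj_of_ne_zero [hρ : ρ.IsIrreducible]
    (f : IntertwiningMap ρ (tauConj hτ ρ)) (hf : f ≠ 0) : Nonempty ((tauConj hτ ρ).Equiv ρ) := by
  have := tauConj_isIrreducible hτ ρ hρ
  exact ⟨(f.ofBijective ((IsIrreducible.bijective_or_eq_zero f).resolve_right hf)).symm⟩

theorem nonempty_equiv_of_twistedIndicator_ne_zero [hρ : ρ.IsIrreducible]
    (h : twistedIndicator τ ρ.character ≠ 0) : Nonempty ((tauConj hτ ρ).Equiv ρ) := by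
  by_contra hne
  apply h
  rw [twistedIndicator_eq_sum hτ ρ (Module.finBasis ℂ V)]
  have : ∀ X, averageTwisted hτ ρ X = 0 := fun X => by
    by_contra hX
    exact hne (nonempty_equiv_tauConj_of_ne_zero hτ ρ _ hX)
  simp [this]

/-- If `ρ` is equivalent to its `τ`-conjugate, the equivalence is a twisted form `B`. By Schur's
lemma the transpose of `B` is `s • B` for some `s`, and transposing twice gives `s ^ 2 = 1`. Schur's
lemma also expresses every average of a map `V → V'` as an explicit multiple of `B`, which
identifies the indicator with `s`. -/
theorem exists_isTwistedForm [hρ : ρ.IsIrreducible] (e : (tauConj hτ ρ).Equiv ρ) :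
    ∃ (s : ℂ) (B : V →ₗ[ℂ] Module.Dual ℂ V), (s = 1 ∨ s = -1) ∧ IsTwistedForm τ ρ s B ∧
      twistedIndicator τ ρ.character = s := by
  have hnt := nontrivial_of_isIrreducible hρ
  have schur : ∀ f : IntertwiningMap ρ (tauConj hτ ρ), ∃ c : ℂ, ∀ v, f v = c • e.symm v := by
    intro f
    obtain ⟨c, hc⟩ := (IsIrreducible.algebraMap_intertwiningMap_bijective_of_isAlgClosed (ρ := ρ)
      ).2 (e.toIntertwiningMap.comp f)
    refine ⟨c, fun v => ?_⟩
    have h := congrArg (fun F : IntertwiningMap ρ ρ => e.symm (F v)) hc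
    simpa using h.symm
  let B : V →ₗ[ℂ] Module.Dual ℂ V := e.symm.toLinearEquiv.toLinearMap
  have hBe : ∀ v, B v = e.symm v := fun v => rfl
  have hB : ∀ g v w, B (ρ g v) w = B v (ρ (τ g) w) := by
    intro g v w
    have := IntertwiningMap.isIntertwining _ _ e.symm.toIntertwiningMap g v
    exact congrArg (fun φ : Module.Dual ℂ V => φ w) this
  let B' : IntertwiningMap ρ (tauConj hτ ρ) := ⟨B.flip, fun g => by
    ext v w
    have := hB (τ g) w v
    rw [hτ.apply_apply] at this
    exact this.symm⟩
  obtain ⟨s, hs⟩ := schur B'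
  have hswap' : ∀ v w, B w v = s * B v w := fun v w =>
    congrArg (fun φ : Module.Dual ℂ V => φ w) (hs v)
  have hswap : ∀ v w, B v w = s * B w v := fun v w => hswap' w v
  obtain ⟨v, hv⟩ := exists_ne (0 : V)
  have hinj : Function.Injective B := e.symm.toLinearEquiv.injective
  have hs2 : s = 1 ∨ s = -1 := by
    obtain ⟨w, hw⟩ : ∃ w, B v w ≠ 0 := by
      by_contra! h
      exact hv (hinj (by rw [map_zero]; ext w; exact h w))
    apply mul_self_eq_one_iff.1
    have h1 := hswap v w
    rw [hswap w v] at h1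
    refine mul_right_cancel₀ hw ?_
    linear_combination -h1
  refine ⟨s, B, hs2, ⟨hinj, hB, hswap⟩, ?_⟩
  let n := Module.finrank ℂ V
  have hn : (n : ℂ) ≠ 0 := Nat.cast_ne_zero.2 Module.finrank_pos.ne'
  -- An average is a multiple of `B`; the factor is found by composing with `e = B⁻¹` and taking
  -- traces.
  have hcoef : ∀ X v, averageTwisted hτ ρ X v =
      ((Nat.card G : ℂ) * (n : ℂ)⁻¹ *
        LinearMap.trace ℂ V (e.toLinearEquiv.toLinearMap ∘ₗ X)) • B v := by
    intro X
    obtain ⟨c, hc⟩ := schur (averageTwisted hτ ρ X)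
    have htr : (Nat.card G : ℂ) *
        LinearMap.trace ℂ V (e.toLinearEquiv.toLinearMap ∘ₗ X) = c * n := by
      have h1 : e.toLinearEquiv.toLinearMap ∘ₗ (averageTwisted hτ ρ X).toLinearMap
          = c • LinearMap.id := by
        ext v
        have := congrArg e (hc v)
        simpa using this
      have h2 : e.toLinearEquiv.toLinearMap ∘ₗ (averageTwisted hτ ρ X).toLinearMap
          = ∑ h, ρ h⁻¹ * ((e.toLinearEquiv.toLinearMap ∘ₗ X) * ρ h) := by
        ext v
        have := congrArg e (averageTwisted_apply hτ ρ X v)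
        rw [map_sum] at this
        rw [LinearMap.sum_apply]
        refine this.trans (Finset.sum_congr rfl fun h _ => ?_)
        exact IntertwiningMap.isIntertwining _ _ e.toIntertwiningMap h⁻¹ _
      have h3 := congrArg (LinearMap.trace ℂ V) (h2.symm.trans h1)
      rw [map_smul, LinearMap.trace_id, smul_eq_mul, map_sum] at h3
      rw [← h3, Finset.sum_congr rfl fun h _ => (LinearMap.trace_mul_comm ℂ _ _).trans
        (congrArg _ (show _ = e.toLinearEquiv.toLinearMap ∘ₗ X by
          rw [mul_assoc, ← map_mul, mul_inv_cancel, map_one, mul_one]))]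
      simp
    intro v
    rw [hc v, hBe]
    congr 1
    rw [mul_right_comm, htr, mul_inv_cancel_right₀ hn]
  let b := Module.finBasis ℂ V
  rw [twistedIndicator_eq_sum hτ ρ b]
  simp only [hcoef]
  have htrace : ∀ a c, LinearMap.trace ℂ V (e.toLinearEquiv.toLinearMap ∘ₗ
      (b.coord c).smulRight (b.coord a)) = b.coord c (e (b.coord a)) := by
    intro a c
    have : e.toLinearEquiv.toLinearMap ∘ₗ (b.coord c).smulRight (b.coord a) =
        (b.coord c).smulRight (e (b.coord a)) := by
      ext v
      simp only [LinearMap.comp_apply, LinearMap.smulRight_apply, map_smul]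
      rfl
    rw [this, LinearMap.trace_smulRight]
  simp only [htrace]
  have hin : ∀ a, ∑ c, b.coord c (e (b.coord a)) * B (b a) (b c) = s := by
    intro a
    have : ∀ c, b.coord c (e (b.coord a)) * B (b a) (b c)
        = s * (B (b.coord c (e (b.coord a)) • b c) (b a)) := by
      intro c
      rw [hswap (b a) (b c), map_smul, LinearMap.smul_apply, smul_eq_mul]
      ring
    rw [Finset.sum_congr rfl fun c _ => this c, ← Finset.mul_sum, ← LinearMap.sum_apply, ← map_sum]
    have h1 : ∑ c, b.coord c (e (b.coord a)) • b c = e (b.coord a) := b.sum_repr _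
    rw [h1, hBe, Representation.Equiv.symm_apply_apply]
    simp
  calc _ = (Nat.card G : ℂ)⁻¹ * ∑ a, (Nat.card G : ℂ) * (n : ℂ)⁻¹ *
        ∑ c, b.coord c (e (b.coord a)) * B (b a) (b c) := by
        congr 1
        refine Finset.sum_congr rfl fun a _ => ?_
        rw [Finset.mul_sum]
        refine Finset.sum_congr rfl fun c _ => ?_
        rw [LinearMap.smul_apply, smul_eq_mul]
        ring
    _ = s := by
        have hG := natCard_ne_zero (G := G)
        simp only [hin, Finset.sum_const, Finset.card_univ, Fintype.card_fin, nsmul_eq_mul]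
        change (Nat.card G : ℂ)⁻¹ * ((n : ℂ) * _) = _
        field_simp

end Indicator

/-! ### The two sums in terms of triple multiplicities -/

section Counting

variable {G : Type u} [Group G] [Fintype G]

/-- The pairing with an irreducible character counts the summands equivalent to it. -/
theorem charPairing_of_isInternal {V W : Type*} [AddCommGroup V] [Module ℂ V]
    [FiniteDimensional ℂ V] [AddCommGroup W] [Module ℂ W] [FiniteDimensional ℂ W]
    {π : Representation ℂ G V} {n : ℕ} {σ : Fin n → Subrepresentation π}
    (hirr : ∀ l, (σ l).toRepresentation.IsIrreducible)
    (hσ : DirectSum.IsInternal (fun l => (σ l).toSubmodule))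
    (κ : Representation ℂ G W) (hκ : κ.IsIrreducible) :
    charPairing π.character κ.character =
      Nat.card {l // Nonempty (κ.Equiv (σ l).toRepresentation)} := by
  classical
  have h : π.character = ∑ l, (1 : ℂ) • (σ l).toRepresentation.character := by
    funext g
    simp [character_eq_sum_of_isInternal hσ g]
  have h' : ∀ l, charPairing (σ l).toRepresentation.character κ.character =
      if Nonempty (κ.Equiv (σ l).toRepresentation) then 1 else 0 := fun l => by
    have := hirr l
    have := char_orthonormal (σ l).toRepresentation κ
    convert! this
  rw [h, charPairing_sum_smul]
  simp only [h', one_mul]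
  rw [Nat.card_eq_fintype_card, Fintype.card_subtype]
  simp

theorem abs_mul_mul_le_one {a b c : ℤ} (ha : |a| ≤ 1) (hb : |b| ≤ 1) (hc : |c| ≤ 1) :
    |a * b * c| ≤ 1 := by
  rw [abs_mul, abs_mul]
  exact mul_le_one₀ (mul_le_one₀ ha (abs_nonneg _) hb) (abs_nonneg _) hc

theorem zetaTau_eq_sum (τ : G → G) [DecidableEq G] (g : G) :
    (zetaTau τ g : ℂ) = ∑ h : G, if τ h⁻¹ * h = g then 1 else 0 := by
  rw [zetaTau, Nat.card_eq_fintype_card, Fintype.card_subtype]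
  simp

omit [Fintype G] in
theorem zetaTau_conj {τ : G → G} (hτ : IsInvolutoryAntiAut τ) (g t : G) :
    zetaTau τ (t * g * t⁻¹) = zetaTau τ g := by
  -- The substitution `h ↦ τ(t) h t` conjugates `τ(h⁻¹) h` by `t⁻¹`.
  refine Nat.card_congr (Equiv.subtypeEquiv
    ((Equiv.mulLeft (τ t)).trans (Equiv.mulRight t)) fun h => ?_)
  have key : τ (τ t * h * t)⁻¹ * (τ t * h * t) = t⁻¹ * (τ h⁻¹ * h) * t := by
    simp only [hτ.map_inv, hτ.map_mul, hτ.apply_apply]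
    group
  simp only [Equiv.trans_apply, Equiv.coe_mulLeft, Equiv.coe_mulRight, key]
  rw [eq_mul_inv_iff_mul_eq, mul_assoc t⁻¹, inv_mul_eq_iff_eq_mul]

namespace IrrepSystem

variable (S : IrrepSystem G)

/-- The dimension of the space of invariants in the triple tensor product, that is, the
multiplicity in `ρᵢ ⊗ ρⱼ` of the dual of `ρₖ`. -/
noncomputable def mult (i j k : S.ι) : ℕ :=
  Module.finrank ℂ ((S.rep i).tprod (S.rep j) |>.tprod (S.rep k)).invariants

theorem sum_char_mul_char_mul_char (i j k : S.ι) :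
    ∑ g, S.char i g * S.char j g * S.char k g = Nat.card G * S.mult i j k := by
  rw [mult, ← card_inv_mul_sum_char_eq_finrank, mul_inv_cancel_left₀ natCard_ne_zero]
  simp [char]

omit [Fintype G] in
/-- The values at inverses of an irreducible character form the character of the dual, which is
again irreducible. -/
theorem exists_char_inv (i : S.ι) : ∃ j, ∀ g, S.char i g⁻¹ = S.char j g := by
  obtain ⟨j, hj⟩ := S.exists_char_eq _
    (tauConj_isIrreducible isInvolutoryAntiAut_inv (S.rep i) (S.irreducible i))
  refine ⟨j, fun g => ?_⟩
  rw [← hj, tauConj_character]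
  rfl

theorem char_mul_char_inv (i j : S.ι) (g : G) :
    S.char i g⁻¹ * S.char j g⁻¹ = ∑ k, (S.mult i j k : ℂ) * S.char k g := by
  have h := S.eq_sum_charPairing (f := fun g => S.char i g⁻¹ * S.char j g⁻¹) (fun x y => by
    have : ∀ l, S.char l (y * x * y⁻¹)⁻¹ = S.char l x⁻¹ := fun l => by
      rw [show (y * x * y⁻¹)⁻¹ = y * x⁻¹ * y⁻¹ by group]
      exact char_conj _ _ _
    simp only [this])
  have h' : ∀ k, charPairing (fun g => S.char i g⁻¹ * S.char j g⁻¹) (S.char k) =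
      S.mult i j k := fun k => by
    rw [charPairing, inv_mul_eq_iff_eq_mul₀ natCard_ne_zero, ← sum_char_mul_char_mul_char]
    exact Equiv.sum_comp (Equiv.inv G) (fun g => S.char i g * S.char j g * S.char k g)
  refine (congrFun h g).trans ?_
  simp [h']

/-- Otherwise `χᵢ χⱼ` would vanish at `1`. -/
theorem exists_mult_ne_zero (i j : S.ι) : ∃ k, S.mult i j k ≠ 0 := by
  by_contra! h
  have h1 := S.char_mul_char_inv i j 1
  have hne : ∀ l, S.char l 1 ≠ 0 := fun l => by
    have := nontrivial_of_isIrreducible (S.irreducible l)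
    rw [char, char_one]
    exact Nat.cast_ne_zero.2 Module.finrank_pos.ne'
  simp [h, hne] at h1

theorem sum_centralizerOrder_sq :
    ((∑ g : G, centralizerOrder g ^ 2 : ℕ) : ℂ) =
      Nat.card G * ∑ i, ∑ j, ∑ k, (S.mult i j k : ℂ) ^ 2 := by
  have h : ∀ i j, ∑ g, (S.char i g⁻¹ * S.char i g) * (S.char j g⁻¹ * S.char j g) =
      Nat.card G * ∑ k, (S.mult i j k : ℂ) ^ 2 := by
    intro i j
    calc _ = ∑ g, ∑ k, (S.mult i j k : ℂ) * (S.char i g * S.char j g * S.char k g) := by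
          refine Finset.sum_congr rfl fun g _ => ?_
          rw [show S.char i g⁻¹ * S.char i g * (S.char j g⁻¹ * S.char j g) =
            (S.char i g⁻¹ * S.char j g⁻¹) * (S.char i g * S.char j g) by ring,
            char_mul_char_inv, Finset.sum_mul]
          exact Finset.sum_congr rfl fun k _ => by ring
      _ = _ := by
          rw [Finset.sum_comm, Finset.mul_sum]
          refine Finset.sum_congr rfl fun k _ => ?_
          rw [← Finset.mul_sum, sum_char_mul_char_mul_char]
          ring
  push_cast
  simp only [S.centralizerOrder_eq_sum, sq, Finset.sum_mul_sum]
  rw [Finset.sum_comm, Finset.mul_sum]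
  refine Finset.sum_congr rfl fun i _ => ?_
  rw [Finset.sum_comm, Finset.mul_sum]
  refine Finset.sum_congr rfl fun j _ => ?_
  rw [h]
  simp only [sq]

theorem zetaTau_eq_sum_char {τ : G → G} (hτ : IsInvolutoryAntiAut τ) (g : G) :
    (zetaTau τ g : ℂ) = ∑ i, twistedIndicator τ (S.char i) * S.char i g := by
  classical
  have h := S.eq_sum_charPairing (f := fun g => (zetaTau τ g : ℂ)) (fun x y => by
    rw [zetaTau_conj hτ])
  have h' : ∀ i, charPairing (fun g => (zetaTau τ g : ℂ)) (S.char i) =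
      twistedIndicator τ (S.char i) := fun i => by
    rw [charPairing, twistedIndicator]
    congr 1
    simp only [zetaTau_eq_sum, Finset.sum_mul, ite_mul, one_mul, zero_mul]
    rw [Finset.sum_comm]
    simp only [Finset.sum_ite_eq, Finset.mem_univ, if_true]
    rw [← Equiv.sum_comp (Equiv.inv G)]
    refine Finset.sum_congr rfl fun t _ => ?_
    simp only [Equiv.inv_apply, inv_inv, mul_inv_rev, hτ.map_inv]
    exact char_mul_comm _ _ _
  refine (congrFun h g).trans ?_
  simp [h']

theorem sum_zetaTau_pow_three {τ : G → G} (hτ : IsInvolutoryAntiAut τ) :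
    ((∑ g : G, zetaTau τ g ^ 3 : ℕ) : ℂ) = Nat.card G * ∑ i, ∑ j, ∑ k,
      twistedIndicator τ (S.char i) * twistedIndicator τ (S.char j) *
        twistedIndicator τ (S.char k) * S.mult i j k := by
  push_cast
  simp only [S.zetaTau_eq_sum_char hτ, pow_succ, pow_zero, one_mul,
    Finset.sum_mul]
  simp only [Finset.mul_sum]
  rw [Finset.sum_comm]
  refine Finset.sum_congr rfl fun i _ => ?_
  rw [Finset.sum_comm]
  refine Finset.sum_congr rfl fun j _ => ?_
  simp only [Finset.sum_mul]
  rw [Finset.sum_comm]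
  refine Finset.sum_congr rfl fun k _ => ?_
  rw [mul_left_comm, ← sum_char_mul_char_mul_char, Finset.mul_sum]
  exact Finset.sum_congr rfl fun g _ => by ring

/-- The summands of `ρᵢ ⊗ ρⱼ` equivalent to the dual of `ρₖ` are counted by `S.mult i j k`, and
every irreducible representation is such a dual. -/
theorem kroneckerMultiplicityFree_iff :
    KroneckerMultiplicityFree G ↔ ∀ i j k, S.mult i j k ≤ 1 := by
  have hmult : ∀ i j k (χ ψ : G → ℂ), χ = S.char i * S.char j → (∀ g, ψ g⁻¹ = S.char k g) →
      (S.mult i j k : ℂ) = charPairing χ ψ := by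
    intro i j k χ ψ h1 h2
    rw [charPairing, eq_inv_mul_iff_mul_eq₀ natCard_ne_zero, ← sum_char_mul_char_mul_char]
    simp [h1, h2]
  constructor
  · intro h i j k
    obtain ⟨n, σ, hirr, hne, hσ⟩ := h _ _ (S.rep i) (S.rep j) (S.irreducible i) (S.irreducible j)
    obtain ⟨k', hk'⟩ := S.exists_char_inv k
    have h1 := hmult i j k _ (S.char k') (char_tensor (S.rep i) (S.rep j)) (by simp [← hk'])
    rw [char, charPairing_of_isInternal hirr hσ _ (S.irreducible k'), Nat.cast_inj] at h1
    rw [h1, Finite.card_le_one_iff_subsingleton]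
    refine ⟨fun ⟨l, ⟨e⟩⟩ ⟨l', ⟨e'⟩⟩ => Subtype.ext ?_⟩
    by_contra hl
    exact (hne l l' hl).false (e.symm.trans e')
  · intro h V W _ _ _ _ _ _ ρ₁ ρ₂ h₁ h₂
    obtain ⟨i, hi⟩ := S.exists_char_eq ρ₁ h₁
    obtain ⟨j, hj⟩ := S.exists_char_eq ρ₂ h₂
    obtain ⟨n, σ, hirr, hσ⟩ := exists_isInternal_isIrreducible (ρ₁.tprod ρ₂)
    refine ⟨n, σ, hirr, fun l l' hl => ⟨fun e => hl ?_⟩, hσ⟩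
    obtain ⟨k', hk'⟩ := S.exists_char_eq _ (hirr l)
    obtain ⟨k, hk⟩ := S.exists_char_inv k'
    have h1 := hmult i j k (ρ₁.tprod ρ₂).character (σ l).toRepresentation.character
      (by rw [char_tensor, hi, hj]) (by rw [hk']; exact hk)
    rw [charPairing_of_isInternal hirr hσ _ (hirr l), Nat.cast_inj] at h1
    have h2 := h i j k
    rw [h1, Finite.card_le_one_iff_subsingleton] at h2
    exact congrArg Subtype.val
      (h2.elim ⟨l, ⟨Representation.Equiv.refl _⟩⟩ ⟨l', ⟨e⟩⟩)

theorem exists_int_twistedIndicator {τ : G → G} (hτ : IsInvolutoryAntiAut τ) (i : S.ι) :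
    ∃ e : ℤ, twistedIndicator τ (S.char i) = e ∧ |e| ≤ 1 := by
  by_cases h : twistedIndicator τ (S.char i) = 0
  · exact ⟨0, by simp [h], by simp⟩
  · obtain ⟨e⟩ := nonempty_equiv_of_twistedIndicator_ne_zero hτ (S.rep i) h
    obtain ⟨s, -, hs | hs, -, h'⟩ := exists_isTwistedForm hτ (S.rep i) e
    · exact ⟨1, by simp [char, h', hs], by simp⟩
    · exact ⟨-1, by simp [char, h', hs], by simp⟩

theorem forall_equiv_tauConj_iff {τ : G → G} (hτ : IsInvolutoryAntiAut τ) :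
    (∀ (V : Type u) [AddCommGroup V] [Module ℂ V] [FiniteDimensional ℂ V]
      (ρ : Representation ℂ G V), ρ.IsIrreducible → Nonempty ((tauConj hτ ρ).Equiv ρ)) ↔
      ∀ i, twistedIndicator τ (S.char i) ≠ 0 := by
  constructor
  · intro h i
    obtain ⟨e⟩ := h _ (S.rep i) (S.irreducible i)
    obtain ⟨s, -, hs, -, h'⟩ := exists_isTwistedForm hτ (S.rep i) e
    rw [char, h']
    rcases hs with rfl | rfl <;> norm_num
  · intro h V _ _ _ ρ hρ
    obtain ⟨i, hi⟩ := S.exists_char_eq ρ hρ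
    exact nonempty_equiv_of_twistedIndicator_ne_zero hτ ρ (by rw [hi]; exact h i)

/-- The indicators are the symmetry signs of twisted forms, so their product is the sign of the
tensor product form on a representation whose invariants are one-dimensional. -/
theorem prod_twistedIndicator_eq_one {τ : G → G} (hτ : IsInvolutoryAntiAut τ) {i j k : S.ι}
    (hi : twistedIndicator τ (S.char i) ≠ 0) (hj : twistedIndicator τ (S.char j) ≠ 0)
    (hk : twistedIndicator τ (S.char k) ≠ 0) (hm : S.mult i j k = 1) :
    twistedIndicator τ (S.char i) * twistedIndicator τ (S.char j) *
      twistedIndicator τ (S.char k) = 1 := by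
  have key : ∀ i, twistedIndicator τ (S.char i) ≠ 0 →
      ∃ B, IsTwistedForm τ (S.rep i) (twistedIndicator τ (S.char i)) B := fun i hi => by
    obtain ⟨e⟩ := nonempty_equiv_of_twistedIndicator_ne_zero hτ (S.rep i) hi
    obtain ⟨s, B, -, hB, h'⟩ := exists_isTwistedForm hτ (S.rep i) e
    exact ⟨B, by rwa [char, h']⟩
  obtain ⟨B₁, h₁⟩ := key i hi
  obtain ⟨B₂, h₂⟩ := key j hj
  obtain ⟨B₃, h₃⟩ := key k hk
  exact ((h₁.tensor h₂).tensor h₃).eq_one_of_finrank_invariants hτ hm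

/-- The sums are `|G|` times the sums over `i, j, k` of the two sides of the right-hand condition.
As indicators lie in `{0, 1, -1}` and multiplicities are natural numbers, the left side is at most
the right side in each term, so the sums agree only if all terms do. -/
theorem sum_eq_sum_iff {τ : G → G} (hτ : IsInvolutoryAntiAut τ) :
    ∑ g : G, zetaTau τ g ^ 3 = ∑ g : G, centralizerOrder g ^ 2 ↔
      ∀ i j k, twistedIndicator τ (S.char i) * twistedIndicator τ (S.char j) *
        twistedIndicator τ (S.char k) * S.mult i j k = (S.mult i j k : ℂ) ^ 2 := by
  choose e he hle using S.exists_int_twistedIndicator hτ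
  have hterm : ∀ i j k, e i * e j * e k * S.mult i j k ≤ (S.mult i j k : ℤ) ^ 2 := by
    intro i j k
    have h1 := abs_mul_mul_le_one (hle i) (hle j) (hle k)
    have h2 : (S.mult i j k : ℤ) ≤ (S.mult i j k : ℤ) ^ 2 := by
      exact_mod_cast Nat.le_self_pow two_ne_zero _
    exact (mul_le_of_le_one_left (Int.natCast_nonneg _) ((le_abs_self _).trans h1)).trans h2
  rw [← Nat.cast_inj (R := ℂ), S.sum_zetaTau_pow_three hτ, S.sum_centralizerOrder_sq,
    mul_right_inj' natCard_ne_zero]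
  simp only [he]
  have hcast : ∀ i j k, ((e i : ℂ) * e j * e k * S.mult i j k = (S.mult i j k : ℂ) ^ 2 ↔
      e i * e j * e k * S.mult i j k = (S.mult i j k : ℤ) ^ 2) := fun i j k => by
    rw [← Int.cast_inj (α := ℂ)]
    push_cast
    rfl
  have hcast' : (∑ i, ∑ j, ∑ k, (e i : ℂ) * e j * e k * S.mult i j k =
      ∑ i, ∑ j, ∑ k, (S.mult i j k : ℂ) ^ 2 ↔ ∑ i, ∑ j, ∑ k, e i * e j * e k * S.mult i j k =
      ∑ i, ∑ j, ∑ k, (S.mult i j k : ℤ) ^ 2) := by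
    rw [← Int.cast_inj (α := ℂ)]
    push_cast
    rfl
  rw [hcast', Finset.sum_eq_sum_iff_of_le fun i _ => Finset.sum_le_sum fun j _ =>
    Finset.sum_le_sum fun k _ => hterm i j k]
  simp only [Finset.mem_univ, true_imp_iff]
  refine forall_congr' fun i => ?_
  rw [Finset.sum_eq_sum_iff_of_le fun j _ => Finset.sum_le_sum fun k _ => hterm i j k]
  simp only [Finset.mem_univ, true_imp_iff]
  refine forall_congr' fun j => ?_
  rw [Finset.sum_eq_sum_iff_of_le fun k _ => hterm i j k]
  simp only [Finset.mem_univ, true_imp_iff]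
  exact forall_congr' fun k => (hcast i j k).symm

end IrrepSystem

theorem isTauSimplyReducible_iff {τ : G → G} (hτ : IsInvolutoryAntiAut τ) :
    IsTauSimplyReducible G hτ ↔
      ∑ g : G, zetaTau τ g ^ 3 = ∑ g : G, centralizerOrder g ^ 2 := by
  obtain ⟨S⟩ := exists_irrepSystem G
  rw [IsTauSimplyReducible, S.kroneckerMultiplicityFree_iff, S.forall_equiv_tauConj_iff,
    S.sum_eq_sum_iff hτ]
  constructor
  · rintro ⟨hm, hε⟩ i j k
    rcases Nat.le_one_iff_eq_zero_or_eq_one.1 (hm i j k) with h | h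
    · simp [h]
    · rw [S.prod_twistedIndicator_eq_one hτ (hε i) (hε j) (hε k) h, h]
      norm_num
  · intro h
    have h' : ∀ i j k, S.mult i j k ≠ 0 → twistedIndicator τ (S.char i) *
        twistedIndicator τ (S.char j) * twistedIndicator τ (S.char k) = S.mult i j k :=
      fun i j k hm => mul_right_cancel₀ (Nat.cast_ne_zero.2 hm) ((h i j k).trans (sq _))
    refine ⟨fun i j k => ?_, fun i h0 => ?_⟩
    · by_cases hm : S.mult i j k = 0
      · simp [hm]
      · obtain ⟨a, ha, ha'⟩ := S.exists_int_twistedIndicator hτ i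
        obtain ⟨b, hb, hb'⟩ := S.exists_int_twistedIndicator hτ j
        obtain ⟨c, hc, hc'⟩ := S.exists_int_twistedIndicator hτ k
        have h1 := h' i j k hm
        rw [ha, hb, hc] at h1
        have h2 : a * b * c = S.mult i j k := by exact_mod_cast h1
        have h3 := (le_abs_self _).trans (abs_mul_mul_le_one ha' hb' hc')
        omega
    · obtain ⟨k, hk⟩ := S.exists_mult_ne_zero i i
      have := h' i i k hk
      simp only [h0, zero_mul] at this
      exact hk (Nat.cast_eq_zero.1 this.symm)

end Counting

theorem corollary6p6 {G : Type u} [Group G] [Fintype G] {τ : G → G}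
    (hτ : IsInvolutoryAntiAut τ) :
    (IsTauSimplyReducible G hτ ↔
      ∑ g : G, zetaTau τ g ^ 3 = ∑ g : G, centralizerOrder g ^ 2) ∧
    (IsSimplyReducible G ↔
      ∑ g : G, zetaSq g ^ 3 = ∑ g : G, centralizerOrder g ^ 2) := by
  refine ⟨isTauSimplyReducible_iff hτ, ?_⟩
  have hζ : ∀ g : G, zetaSq g = zetaTau (fun g : G => g⁻¹) g := fun g => by
    simp only [zetaSq, zetaTau, inv_inv, sq]
  simp only [hζ]
  exact isTauSimplyReducible_iff isInvolutoryAntiAut_inv
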